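/- Let $K$ be an algebraically closed field and let $A=\bigoplus_{i\ge 0}A_i$ be a positively graded, finite-dimensional $K$-algebra that is self-injective, i.e. injective as a right module over itself. Let $\mathrm{mod}^{\mathbb Z}A$ be the category of finitely generated $\mathbb Z$-graded right $A$-modules with degree-preserving homomorphisms, and let $\underline{\mathrm{mod}}^{\mathbb Z}A$ be its stable category, in which $\underline{\mathrm{Hom}}_A(X,Y)_0$ is the quotient of $\mathrm{Hom}_A(X,Y)_0$ by the morphisms that factor through a projective object of $\mathrm{mod}^{\mathbb Z}A$. For a graded module $X$ let $X(i)$ be the shift with $X(i)_j=X_{i+j}$, and let $X_{\le 0}=X/X_{\ge 1}$, where $X_{\ge 1}=\bigoplus_{j\ge 1}X_j$. Let $$T=\bigoplus_{i\ge 0}A(i)_{\le 0},\qquad \Gamma=\underline{\mathrm{End}}_A(T)_0 .$$ Here $T$ is regarded as an object of $\underline{\mathrm{mod}}^{\mathbb Z}A$ by omitting all but finitely many summands, where every omitted summand is projective (hence zero in the stable category); this is possible because $A(i)_{\le 0}=A(i)$ for all large $i$. That is, $T=\bigoplus_{i\in S}A(i)_{\le 0}$ for any finite set $S$ of non-negative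 integers such that $A(i)_{\le 0}$ is projective in $\mathrm{mod}^{\mathbb Z}A$ for all $i\ge 0$ with $i\notin S$. If $A_0$ has finite global dimension, then $\Gamma$ also has finite global dimension (for every such choice of $S$). -/

import Mathlib

universe u v

/-- The ring `R` has finite (right) global dimension: there is a uniform bound on the projective
dimensions of all right `R`-modules. -/
def HasFiniteGlobalDimension (R : Type u) [Ring R] : Prop :=
  ∃ n : ℕ, ∀ M : ModuleCat.{u} Rᵐᵒᵖ, CategoryTheory.HasProjectiveDimensionLE M n

/-- An object of `mod^ℤ A`: a finitely generated right `A`-module `X` (that is, a module over `Aᵐᵒᵖ`)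
with a decomposition `X = ⨁ i, X_i` such that `X_i A_j ⊆ X_{i+j}`. -/
structure GrMod {K : Type v} {A : Type u} [Field K] [Ring A] [Algebra K A]
    (𝒜 : ℤ → Submodule K A) where
  carrier : Type u
  [addCommGroup : AddCommGroup carrier]
  [module : Module Aᵐᵒᵖ carrier]
  [finite : Module.Finite Aᵐᵒᵖ carrier]
  deg : ℤ → AddSubgroup carrier
  isInternal : DirectSum.IsInternal deg
  smul_mem : ∀ {i j : ℤ} {x : carrier} {a : A}, x ∈ deg i → a ∈ 𝒜 j →
    MulOpposite.op a • x ∈ deg (i + j)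

namespace GrMod

attribute [instance] GrMod.addCommGroup GrMod.module GrMod.finite

/-! Direct sum decompositions and their projections. -/

theorem proj_coeAddMonoidHom {M : Type u} [AddCommGroup M] {D : ℤ → AddSubgroup M}
    {p : ℤ → M →+ M} (hp : ∀ i, ∀ x ∈ D i, p i x = x)
    (hp' : ∀ i j, i ≠ j → ∀ x ∈ D j, p i x = 0) (w : DirectSum ℤ (fun i => D i)) (i : ℤ) :
    p i (DirectSum.coeAddMonoidHom D w) = (w i : M) := by
  induction w using DirectSum.induction_on with
  | zero => simp
  | of j x =>
    by_cases h : i = j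
    · subst h; simp [hp _ _ x.2]
    · rw [DirectSum.coeAddMonoidHom_of, hp' i j h x x.2, DirectSum.of_eq_of_ne _ _ _ h]
      rfl
  | add x y hx hy => simp [hx, hy]

theorem isInternal_of_proj {M : Type u} [AddCommGroup M] (D : ℤ → AddSubgroup M)
    (p : ℤ → M →+ M) (hp : ∀ i, ∀ x ∈ D i, p i x = x)
    (hp' : ∀ i j, i ≠ j → ∀ x ∈ D j, p i x = 0)
    (hgen : ∀ H : AddSubgroup M, (∀ i, D i ≤ H) → ∀ x, x ∈ H) : DirectSum.IsInternal D := by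
  constructor
  · rw [injective_iff_map_eq_zero]
    intro w hw
    ext i
    have := proj_coeAddMonoidHom hp hp' w i
    rw [hw, map_zero] at this
    simpa using this.symm
  · intro x
    exact hgen (DirectSum.coeAddMonoidHom D).range
      (fun i y hy => ⟨DirectSum.of (fun i => D i) i ⟨y, hy⟩, by simp⟩) x

theorem exists_proj {M : Type u} [AddCommGroup M] {D : ℤ → AddSubgroup M}
    (h : DirectSum.IsInternal D) :
    ∃ p : ℤ → M →+ M, (∀ i x, p i x ∈ D i) ∧ (∀ i, ∀ x ∈ D i, p i x = x) ∧
      (∀ i j, i ≠ j → ∀ x ∈ D j, p i x = 0) := by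
  let _ : DirectSum.Decomposition D := h.chooseDecomposition
  refine ⟨fun i => (D i).subtype.comp
    ((DFinsupp.evalAddMonoidHom i).comp (DirectSum.decomposeAddEquiv D).toAddMonoidHom), ?_, ?_, ?_⟩
  · intro i x
    exact SetLike.coe_mem _
  · intro i x hx
    exact DirectSum.decompose_of_mem_same D hx
  · intro i j hij x hx
    exact DirectSum.decompose_of_mem_ne D hx hij.symm

theorem mem_of_deg_le {M : Type u} [AddCommGroup M] {D : ℤ → AddSubgroup M}
    (h : DirectSum.IsInternal D) (H : AddSubgroup M) (hH : ∀ i, D i ≤ H) (x : M) : x ∈ H := by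
  obtain ⟨w, rfl⟩ := h.2 x
  induction w using DirectSum.induction_on with
  | zero => simp [H.zero_mem]
  | of j x => simpa using hH j x.2
  | add x y hx hy => rw [map_add]; exact H.add_mem hx hy

variable {K : Type v} {A : Type u} [Field K] [Ring A] [Algebra K A] (𝒜 : ℤ → Submodule K A)

/-- The algebra `A` itself as a graded right `A`-module. -/
def regular [GradedAlgebra 𝒜] : GrMod 𝒜 where
  carrier := A
  finite := ⟨⟨{1}, by
    rw [eq_top_iff]
    intro a _
    simpa using Submodule.smul_mem (Submodule.span Aᵐᵒᵖ ({1} : Set A)) (MulOpposite.op a)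
      (Submodule.mem_span_singleton_self 1)⟩⟩
  deg := fun i => (𝒜 i).toAddSubgroup
  isInternal := DirectSum.Decomposition.isInternal 𝒜
  smul_mem := fun hx ha => SetLike.GradedMul.mul_mem (A := 𝒜) hx ha

variable {𝒜}

/-- The grade shift `X(n)`, with `X(n)_j = X_{j+n}`. -/
def shift (X : GrMod 𝒜) (n : ℤ) : GrMod 𝒜 where
  carrier := X.carrier
  deg := fun j => X.deg (j + n)
  isInternal := by
    obtain ⟨p, -, h2, h3⟩ := exists_proj X.isInternal
    refine isInternal_of_proj _ (fun i => p (i + n)) (fun i => h2 _)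
      (fun i j hij => h3 _ _ (by simpa using hij)) (fun H hH => ?_)
    refine mem_of_deg_le X.isInternal H (fun i => ?_)
    have := hH (i - n)
    rwa [sub_add_cancel] at this
  smul_mem := by
    intro i j x a hx ha
    have := X.smul_mem hx ha
    rwa [add_right_comm] at this

/-- The submodule `X_{≥ n}` generated by the homogeneous elements of degree at least `n`. When `A`
is positively graded, this is `⨁_{j ≥ n} X_j`; see `mem_truncGE_iff`. -/
def truncGE (X : GrMod 𝒜) (n : ℤ) : Submodule Aᵐᵒᵖ X.carrier :=
  Submodule.span Aᵐᵒᵖ {x | ∃ j, n ≤ j ∧ x ∈ X.deg j}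

theorem smul_mem_of_proj [GradedAlgebra 𝒜] (X : GrMod 𝒜) {p : ℤ → X.carrier →+ X.carrier}
    (hp : ∀ i, ∀ x ∈ X.deg i, p i x = x) (hp' : ∀ i j, i ≠ j → ∀ x ∈ X.deg j, p i x = 0)
    (H : AddSubgroup X.carrier) (y : X.carrier)
    (h : ∀ k j, ∀ b ∈ 𝒜 j, MulOpposite.op b • p k y ∈ H) (a : A) :
    MulOpposite.op a • y ∈ H := by
  classical
  have sums : ∃ s : Finset ℤ, y = ∑ k ∈ s, p k y := by
    obtain ⟨w, rfl⟩ := X.isInternal.2 y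
    refine ⟨w.support, ?_⟩
    simp only [proj_coeAddMonoidHom hp hp']
    exact DirectSum.coeAddMonoidHom_eq_dfinsuppSum _ _
  obtain ⟨s, hs⟩ := sums
  have step : ∀ j, ∀ b ∈ 𝒜 j, MulOpposite.op b • y ∈ H := by
    intro j b hb
    rw [hs, Finset.smul_sum]
    exact H.sum_mem (fun k _ => h k j b hb)
  rw [← DirectSum.sum_support_decompose 𝒜 a, Finset.op_sum, Finset.sum_smul]
  exact H.sum_mem (fun j _ => step j _ (SetLike.coe_mem _))

theorem proj_mem_truncGE [GradedAlgebra 𝒜] (X : GrMod 𝒜) (n : ℤ)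
    {p : ℤ → X.carrier →+ X.carrier} (hm : ∀ i x, p i x ∈ X.deg i)
    (hp : ∀ i, ∀ x ∈ X.deg i, p i x = x) (hp' : ∀ i j, i ≠ j → ∀ x ∈ X.deg j, p i x = 0)
    (x : X.carrier) (hx : x ∈ X.truncGE n) : ∀ i, p i x ∈ X.truncGE n := by
  have hom : ∀ j, ∀ y ∈ X.deg j, y ∈ X.truncGE n → ∀ i, p i y ∈ X.truncGE n := by
    intro j y hy hyN i
    by_cases h : i = j
    · subst h; rwa [hp i y hy]
    · rw [hp' i j h y hy]; exact Submodule.zero_mem _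
  induction hx using Submodule.span_induction with
  | mem y hy =>
    obtain ⟨j, hj, hy⟩ := hy
    exact hom j y hy (Submodule.subset_span ⟨j, hj, hy⟩)
  | zero => intro i; rw [map_zero]; exact Submodule.zero_mem _
  | add y z _ _ hy hz => intro i; rw [map_add]; exact Submodule.add_mem _ (hy i) (hz i)
  | smul a y _ hy =>
    intro i
    exact X.smul_mem_of_proj hp hp' ((X.truncGE n).toAddSubgroup.comap (p i)) y
      (fun k j b hb => hom (k + j) _ (X.smul_mem (hm k y) hb) (Submodule.smul_mem _ _ (hy k)) i)
      a.unop

/-- The graded factor module `X_{≤ n} = X / X_{≥ n+1}`. -/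
def truncLE [GradedAlgebra 𝒜] (X : GrMod 𝒜) (n : ℤ) : GrMod 𝒜 where
  carrier := X.carrier ⧸ X.truncGE (n + 1)
  deg := fun j => (X.deg j).map (X.truncGE (n + 1)).mkQ.toAddMonoidHom
  isInternal := by
    obtain ⟨p, h1, h2, h3⟩ := exists_proj X.isInternal
    have hN := X.proj_mem_truncGE (n + 1) h1 h2 h3
    refine isInternal_of_proj _ (fun i => QuotientAddGroup.map _ _ (p i) (fun x hx => hN x hx i))
      ?_ ?_ ?_
    · rintro i _ ⟨x, hx, rfl⟩
      exact congrArg (X.truncGE (n + 1)).mkQ (h2 i x hx)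
    · rintro i j hij _ ⟨x, hx, rfl⟩
      exact (congrArg (X.truncGE (n + 1)).mkQ (h3 i j hij x hx)).trans (map_zero _)
    · intro H hH x
      obtain ⟨x, rfl⟩ := (X.truncGE (n + 1)).mkQ_surjective x
      exact mem_of_deg_le X.isInternal (H.comap (X.truncGE (n + 1)).mkQ.toAddMonoidHom)
        (fun i y hy => hH i ⟨y, hy, rfl⟩) x
  smul_mem := by
    rintro i j _ a ⟨x, hx, rfl⟩ ha
    exact ⟨_, X.smul_mem hx ha, map_smul (X.truncGE (n + 1)).mkQ _ _⟩

/-- The direct sum of a finite family of graded modules, with `(⨁ X_s)_j = ⨁ (X_s)_j`. -/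
def directSum {ι : Type} [Fintype ι] (X : ι → GrMod 𝒜) : GrMod 𝒜 where
  carrier := ∀ s, (X s).carrier
  deg := fun j => AddSubgroup.pi Set.univ (fun s => (X s).deg j)
  isInternal := by
    classical
    choose p h1 h2 h3 using fun s => exists_proj (X s).isInternal
    refine isInternal_of_proj _ (fun i => AddMonoidHom.mk' (fun x s => p s i (x s))
      (fun x y => by ext s; simp)) ?_ ?_ ?_
    · intro i x hx
      ext s
      exact h2 s i _ (hx s trivial)
    · intro i j hij x hx
      ext s
      exact h3 s i j hij _ (hx s trivial)
    · intro H hH x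
      rw [← Finset.univ_sum_single x]
      refine AddSubgroup.sum_mem _ (fun s _ => ?_)
      refine mem_of_deg_le (X s).isInternal
        (H.comap (AddMonoidHom.single (fun s => (X s).carrier) s)) (fun i y hy => hH i ?_) (x s)
      intro t _
      by_cases h : t = s
      · subst h; simpa using hy
      · simp [h]
  smul_mem := fun hx ha s _ => (X s).smul_mem (hx s trivial) ha

/-- `Hom_A(X, Y)_0`: the morphisms of `mod^ℤ A`. -/
def Hom₀ (X Y : GrMod 𝒜) : AddSubgroup (X.carrier →ₗ[Aᵐᵒᵖ] Y.carrier) where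
  carrier := {f | ∀ i, ∀ x ∈ X.deg i, f x ∈ Y.deg i}
  zero_mem' := fun i _ _ => (Y.deg i).zero_mem
  add_mem' := fun hf hg i x hx => (Y.deg i).add_mem (hf i x hx) (hg i x hx)
  neg_mem' := fun hf i x hx => (Y.deg i).neg_mem (hf i x hx)

/-- `End_A(X)_0`, with composition as multiplication. -/
def End₀ (X : GrMod 𝒜) : Subring (Module.End Aᵐᵒᵖ X.carrier) where
  carrier := X.Hom₀ X
  zero_mem' := (X.Hom₀ X).zero_mem
  add_mem' := (X.Hom₀ X).add_mem
  neg_mem' := (X.Hom₀ X).neg_mem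
  one_mem' := fun _ _ hx => hx
  mul_mem' := fun hf hg i x hx => hf i _ (hg i x hx)

/-- `P` is a projective object of `mod^ℤ A`: it has the lifting property with respect to the
surjective morphisms of `mod^ℤ A`. -/
def IsProjective (P : GrMod 𝒜) : Prop :=
  ∀ (X Y : GrMod 𝒜), ∀ e ∈ X.Hom₀ Y, Function.Surjective e → ∀ f ∈ P.Hom₀ Y,
    ∃ g ∈ P.Hom₀ X, e ∘ₗ g = f

/-- The morphism `f` factors in `mod^ℤ A` through a projective object of `mod^ℤ A`. -/
def FactorsThroughProjective {X Y : GrMod 𝒜} (f : X.carrier →ₗ[Aᵐᵒᵖ] Y.carrier) : Prop :=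
  ∃ P : GrMod 𝒜, P.IsProjective ∧ ∃ g ∈ X.Hom₀ P, ∃ h ∈ P.Hom₀ Y, f = h ∘ₗ g

theorem IsProjective.directSum {ι : Type} [Fintype ι] {P : ι → GrMod 𝒜}
    (hP : ∀ s, (P s).IsProjective) : (GrMod.directSum P).IsProjective := by
  classical
  intro X Y e he hs (f : (∀ s, (P s).carrier) →ₗ[Aᵐᵒᵖ] Y.carrier) hf
  have hf' : ∀ s, f ∘ₗ LinearMap.single Aᵐᵒᵖ (fun s => (P s).carrier) s ∈ (P s).Hom₀ Y := by
    intro s i x hx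
    refine hf i (Pi.single s x) (fun t _ => ?_)
    by_cases h : t = s
    · subst h; simpa using hx
    · simp [h]
  choose g hg hgf using fun s => hP s X Y e he hs _ (hf' s)
  let G : (∀ s, (P s).carrier) →ₗ[Aᵐᵒᵖ] X.carrier :=
    ∑ s, g s ∘ₗ LinearMap.proj (φ := fun s => (P s).carrier) s
  have hG : ∀ x : ∀ s, (P s).carrier, G x = ∑ s, g s (x s) := fun x => by
    rw [LinearMap.sum_apply]; rfl
  refine ⟨G, fun i x hx => ?_, LinearMap.ext (fun x => ?_)⟩
  · exact (hG x).symm ▸ AddSubgroup.sum_mem _ (fun s _ => hg s i _ (hx s trivial))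
  · have h : ∀ x : ∀ s, (P s).carrier, e (G x) = f x := fun x => by
      rw [hG x, map_sum]
      conv_rhs => rw [← Finset.univ_sum_single x, map_sum]
      exact Finset.sum_congr rfl (fun s _ => LinearMap.congr_fun (hgf s) (x s))
    exact h x

theorem FactorsThroughProjective.sum {ι : Type} [Fintype ι] {X Y : GrMod 𝒜} (P : ι → GrMod 𝒜)
    (hP : ∀ s, (P s).IsProjective) (g : ∀ s, X.carrier →ₗ[Aᵐᵒᵖ] (P s).carrier)
    (hg : ∀ s, g s ∈ X.Hom₀ (P s)) (h : ∀ s, (P s).carrier →ₗ[Aᵐᵒᵖ] Y.carrier)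
    (hh : ∀ s, h s ∈ (P s).Hom₀ Y) : FactorsThroughProjective (∑ s, h s ∘ₗ g s) := by
  let H : (∀ s, (P s).carrier) →ₗ[Aᵐᵒᵖ] Y.carrier :=
    ∑ s, h s ∘ₗ LinearMap.proj (φ := fun s => (P s).carrier) s
  have hH : ∀ x : ∀ s, (P s).carrier, H x = ∑ s, h s (x s) := fun x => by
    rw [LinearMap.sum_apply]; rfl
  refine ⟨GrMod.directSum P, IsProjective.directSum hP, LinearMap.pi g,
    fun i x hx s _ => hg s i x hx, H, fun i x hx => ?_, LinearMap.ext (fun x => ?_)⟩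
  · exact (hH x).symm ▸ AddSubgroup.sum_mem _ (fun s _ => hh s i _ (hx s trivial))
  · rw [LinearMap.sum_apply]
    exact (hH (LinearMap.pi g x)).symm

theorem FactorsThroughProjective.zero (X Y : GrMod 𝒜) :
    FactorsThroughProjective (0 : X.carrier →ₗ[Aᵐᵒᵖ] Y.carrier) := by
  simpa using FactorsThroughProjective.sum (X := X) (Y := Y) (fun s : Empty => s.elim)
    (fun s => s.elim) (fun s => s.elim) (fun s => s.elim) (fun s => s.elim) (fun s => s.elim)

theorem FactorsThroughProjective.add {X Y : GrMod 𝒜} {f f' : X.carrier →ₗ[Aᵐᵒᵖ] Y.carrier}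
    (hf : FactorsThroughProjective f) (hf' : FactorsThroughProjective f') :
    FactorsThroughProjective (f + f') := by
  obtain ⟨P, hP, g, hg, h, hh, rfl⟩ := hf
  obtain ⟨P', hP', g', hg', h', hh', rfl⟩ := hf'
  have := FactorsThroughProjective.sum (X := X) (Y := Y) (fun b : Bool => if b then P' else P)
    (by rintro (_ | _) <;> assumption)
    (by rintro (_ | _); exacts [g, g']) (by rintro (_ | _) <;> assumption)
    (by rintro (_ | _); exacts [h, h']) (by rintro (_ | _) <;> assumption)
  rw [Fintype.sum_bool, add_comm] at this
  exact this

/-- The ideal of `End_A(X)_0` of the morphisms that factor through projective objects. -/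
def projIdeal (X : GrMod 𝒜) : TwoSidedIdeal X.End₀ :=
  TwoSidedIdeal.mk' {f : X.End₀ | FactorsThroughProjective (X := X) (Y := X) f.1}
    (FactorsThroughProjective.zero X X)
    (fun hf hg => hf.add hg)
    (by
      rintro f ⟨P, hP, g, hg, h, hh, e⟩
      exact ⟨P, hP, g, hg, -h, AddSubgroup.neg_mem _ hh, by
        rw [LinearMap.neg_comp, ← e]; rfl⟩)
    (by
      rintro k f ⟨P, hP, g, hg, h, hh, e⟩
      exact ⟨P, hP, g, hg, k.1 ∘ₗ h, fun i x hx => k.2 i _ (hh i x hx), by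
        rw [LinearMap.comp_assoc, ← e]; rfl⟩)
    (by
      rintro f k ⟨P, hP, g, hg, h, hh, e⟩
      exact ⟨P, hP, g ∘ₗ k.1, fun i x hx => hg i _ (k.2 i x hx), h, hh, by
        rw [← LinearMap.comp_assoc, ← e]; rfl⟩)

/-- The endomorphism ring of `X` in the stable category of `mod^ℤ A`. -/
abbrev StableEnd (X : GrMod 𝒜) : Type u := X.projIdeal.ringCon.Quotient

/-- `A(i)_{≤ 0}`. -/
def shiftTrunc (𝒜 : ℤ → Submodule K A) [GradedAlgebra 𝒜] (i : ℤ) : GrMod 𝒜 :=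
  ((regular 𝒜).shift i).truncLE 0

/-- `⨁_{i ∈ S} A(i)_{≤ 0}` for a finite set `S` of non-negative integers. -/
def truncSum (𝒜 : ℤ → Submodule K A) [GradedAlgebra 𝒜] (S : Finset ℕ) : GrMod 𝒜 :=
  directSum (fun i : S => shiftTrunc 𝒜 ((i : ℕ) : ℤ))

/-- Over a positively graded algebra, `(X_{≥ n})_j` is `X_j` for `j ≥ n` and `0` for `j < n`. -/
theorem mem_truncGE_iff [GradedAlgebra 𝒜] (hpos : ∀ i < 0, 𝒜 i = ⊥) (X : GrMod 𝒜) (n : ℤ) {j : ℤ}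
    {x : X.carrier} (hx : x ∈ X.deg j) : x ∈ X.truncGE n ↔ n ≤ j ∨ x = 0 := by
  obtain ⟨p, h1, h2, h3⟩ := exists_proj X.isInternal
  constructor
  · intro hN
    by_cases hj : n ≤ j
    · exact Or.inl hj
    right
    suffices h : ∀ i, i < n → p i x = 0 by rw [← h2 j x hx]; exact h j (not_le.mp hj)
    clear hx hj j
    induction hN using Submodule.span_induction with
    | mem y hy =>
      obtain ⟨k, hk, hy⟩ := hy
      exact fun i hi => h3 i k (by omega) y hy
    | zero => intro i _; exact map_zero _
    | add y z _ _ hy hz => intro i hi; rw [map_add, hy i hi, hz i hi, add_zero]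
    | smul a y _ hy =>
      intro i hi
      refine X.smul_mem_of_proj h2 h3 (p i).ker y (fun k j b hb => ?_) a.unop
      rw [AddMonoidHom.mem_ker]
      by_cases hk : k < n
      · rw [hy k hk, smul_zero, map_zero]
      by_cases hj : j < 0
      · rw [hpos j hj, Submodule.mem_bot] at hb
        rw [hb, MulOpposite.op_zero, zero_smul, map_zero]
      · exact h3 i (k + j) (by omega) _ (X.smul_mem (h1 k y) hb)
  · rintro (h | rfl)
    · exact Submodule.subset_span ⟨j, h, hx⟩
    · exact Submodule.zero_mem _

end GrMod

/-!
The proof rests on an explicit description of the stable morphisms between the modules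
`T_m = A(m)_{≤ 0}`. As `T_m` is generated by `1` in degree `-m`, a morphism `T_m → T_n` is left
multiplication by an element of `A_{n-m}`. In particular there are none if `n < m`, and
`End(T_m)_0` is `A_0`.

A morphism `T_m → T_m` that factors through a projective lifts along `A(m) → T_m`; the lift is left
multiplication by the same `a ∈ A_0`, and it is well defined exactly when `a A_{> m} = 0`
(`GrMod.factorsThroughProjective_leftMul_iff`). Hence the stable endomorphism ring of `T_m` is
`A_0 / J`, where `J` is the left annihilator of `A_{> m}` in `A_0`. Self-injectivity gives an
idempotent `e` with `J = e A_0` (`GrMod.exists_left_identity_annihilator`), so `A_0 / J` is a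
projective `A_0`-module, projective `A_0 / J`-modules are projective over `A_0`, and the global
dimension of `A_0 / J` is at most that of `A_0` (`exists_bound_of_ker_eq_mul_idempotent`).

The ring `Γ` is therefore triangular with respect to the idempotents of the summands of `T`, with
diagonal components of finite global dimension, and such a ring has finite global dimension
(`exists_bound_of_triangular`): modules are filtered by their supports on lower sets of indices, the
subquotients are modules over the diagonal components, and restriction of scalars from a diagonal
component raises projective dimensions by a bounded amount.

The ring-theoretic lemmas are stated for left modules and applied to opposite rings.
-/

/-! ### Projective dimension and change of rings -/

open CategoryTheory

theorem hasProjectiveDimensionLT_of_surjective {R : Type u} [Ring R] {M N : Type u}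
    [AddCommGroup M] [Module R M] [AddCommGroup N] [Module R N] (q : M →ₗ[R] N)
    (hq : Function.Surjective q) (n : ℕ)
    (h₁ : HasProjectiveDimensionLT (ModuleCat.of R (LinearMap.ker q)) n)
    (h₂ : HasProjectiveDimensionLT (ModuleCat.of R M) (n + 1)) :
    HasProjectiveDimensionLT (ModuleCat.of R N) (n + 1) :=
  (LinearMap.shortExact_shortComplexKer hq).hasProjectiveDimensionLT_X₃ n h₁ h₂

namespace ModuleCat

theorem restrictScalars_map_shortExact {R S : Type u} [Ring R] [Ring S] (φ : R →+* S)
    {C : ShortComplex (ModuleCat.{u} S)} (h : C.ShortExact) :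
    (C.map (restrictScalars φ)).ShortExact := by
  have hf := h.moduleCat_injective_f
  have hg := h.moduleCat_surjective_g
  have he := (ShortComplex.ShortExact.moduleCat_exact_iff_function_exact _).mp h.exact
  exact ShortComplex.ShortExact.mk'
    ((ShortComplex.ShortExact.moduleCat_exact_iff_function_exact _).mpr he)
    ((ModuleCat.mono_iff_injective _).mpr hf) ((ModuleCat.epi_iff_surjective _).mpr hg)

/-- Restriction of scalars raises the projective dimension by at most its maximum on projective
modules. -/
theorem hasProjectiveDimensionLT_restrictScalars {R S : Type u} [Ring R] [Ring S] (φ : R →+* S)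
    (c : ℕ) (hc : ∀ P : ModuleCat.{u} S, Projective P →
      HasProjectiveDimensionLT ((restrictScalars φ).obj P) (c + 1))
    (n : ℕ) (M : ModuleCat.{u} S) (hM : HasProjectiveDimensionLE M n) :
    HasProjectiveDimensionLT ((restrictScalars φ).obj M) (n + c + 1) := by
  induction n generalizing M with
  | zero =>
    rw [zero_add]
    exact hc M ((projective_iff_hasProjectiveDimensionLE_zero M).mpr hM)
  | succ n ih =>
    have hE := M.shortExact_projectiveShortComplex
    have h₁ := ih _ ((hE.hasProjectiveDimensionLT_X₃_iff n inferInstance).mp hM)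
    have h₂ := hc M.projectiveShortComplex.X₂ inferInstance
    have := (restrictScalars_map_shortExact φ hE).hasProjectiveDimensionLT_X₃ (n + c + 1) h₁
      (@hasProjectiveDimensionLT_of_ge _ _ _ _ (c + 1) (n + c + 1 + 1) (by omega) h₂)
    rwa [add_right_comm n 1 c]

theorem projective_of_restrictScalars {R S : Type u} [Ring R] [Ring S] (φ : R →+* S)
    (hφ : Function.Surjective φ) (P : ModuleCat.{u} S)
    (hP : Projective ((restrictScalars φ).obj P)) : Projective P := by
  refine ⟨fun {E X} f e he => ?_⟩
  have he' : Epi ((restrictScalars φ).map e) :=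
    (ModuleCat.epi_iff_surjective _).mpr ((ModuleCat.epi_iff_surjective e).mp he)
  let g := Projective.factorThru ((restrictScalars φ).map f) ((restrictScalars φ).map e)
  have hg : g ≫ (restrictScalars φ).map e = (restrictScalars φ).map f :=
    Projective.factorThru_comp _ _
  refine ⟨ModuleCat.ofHom
    { toFun := fun x => g.hom x
      map_add' := fun x y => g.hom.map_add x y
      map_smul' := fun s x => ?_ }, ?_⟩
  · obtain ⟨r, rfl⟩ := hφ s
    exact g.hom.map_smul r x
  · ext x
    exact congr($(hg).hom x)

/-- Along a surjection `R → S` for which projective `S`-modules stay projective over `R`, the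
projective dimension over `S` is at most that over `R`. -/
theorem hasProjectiveDimensionLE_of_restrictScalars {R S : Type u} [Ring R] [Ring S] (φ : R →+* S)
    (hφ : Function.Surjective φ)
    (hp : ∀ P : ModuleCat.{u} S, Projective P → Projective ((restrictScalars φ).obj P))
    (n : ℕ) (M : ModuleCat.{u} S)
    (hM : HasProjectiveDimensionLE ((restrictScalars φ).obj M) n) :
    HasProjectiveDimensionLE M n := by
  induction n generalizing M with
  | zero =>
    rw [← projective_iff_hasProjectiveDimensionLE_zero] at hM ⊢
    exact projective_of_restrictScalars φ hφ M hM
  | succ n ih =>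
    have hE := M.shortExact_projectiveShortComplex
    exact (hE.hasProjectiveDimensionLT_X₃_iff n inferInstance).mpr (ih _
      (((restrictScalars_map_shortExact φ hE).hasProjectiveDimensionLT_X₃_iff n
        (hp _ inferInstance)).mp hM))

/-- A module killed by the kernel of a surjection `R → S` is an `S`-module. -/
theorem exists_restrictScalars_iso {R S : Type u} [Ring R] [Ring S] (φ : R →+* S)
    (hφ : Function.Surjective φ) (M : Type u) [AddCommGroup M] [Module R M]
    (hM : ∀ r, φ r = 0 → ∀ x : M, r • x = 0) :
    ∃ N : ModuleCat.{u} S, Nonempty ((restrictScalars φ).obj N ≅ ModuleCat.of R M) := by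
  let g : S →+* AddMonoid.End M :=
    RingHom.liftOfSurjective φ hφ ⟨Module.toAddMonoidEnd R M, fun r hr => by
      ext x; exact hM r hr x⟩
  have hg : ∀ r (x : M), g (φ r) x = r • x := fun r x =>
    congr($(RingHom.liftOfRightInverse_comp_apply φ _ _
      ⟨Module.toAddMonoidEnd R M, fun r hr => by ext x; exact hM r hr x⟩ r) x)
  let _ : Module S M := Module.compHom M g
  refine ⟨ModuleCat.of S M, ⟨LinearEquiv.toModuleIso
    (X₁ := (restrictScalars φ).obj (ModuleCat.of S M)) (X₂ := ModuleCat.of R M)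
    (@AddEquiv.toLinearEquiv R M M _ _ _ ((restrictScalars φ).obj (ModuleCat.of S M)).isModule _
      (AddEquiv.refl M) (fun r x => hg r x))⟩⟩

end ModuleCat

/-- A projective `S`-module is an `R`-linear retract of a sum of copies of `S`. -/
theorem Module.Projective.exists_restrictScalars_retract {R S : Type u} [Ring R] [Ring S]
    (φ : R →+* S) (P : Type u) [AddCommGroup P] [Module S P] [Module.Projective S P] [Module R S]
    [Module R P] (hS : ∀ (r : R) (s : S), r • s = φ r * s)
    (hP : ∀ (r : R) (x : P), r • x = φ r • x) :
    ∃ (i : P →ₗ[R] Π₀ _ : P, S) (p : (Π₀ _ : P, S) →ₗ[R] P), p ∘ₗ i = LinearMap.id := by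
  classical
  obtain ⟨s, hs⟩ := Module.Projective.out (R := S) (P := P)
  refine ⟨{ toFun := fun x => (s x).toDFinsupp
            map_add' := fun x y => by simp
            map_smul' := fun r x => ?_ },
          { toFun := fun w => Finsupp.linearCombination S id w.toFinsupp
            map_add' := fun x y => by simp
            map_smul' := fun r w => ?_ }, ?_⟩
  · rw [hP, map_smul]
    ext p
    simp [hS]
  · have : r • w = φ r • w := by
      ext p
      simp [hS]
    rw [this, DFinsupp.toFinsupp_smul, map_smul, RingHom.id_apply, hP]
  · ext x
    simpa using hs x

/-- If `R → S` is surjective with kernel `R e`, `e` idempotent, then `S ≅ R (1 - e)` is projective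
over `R`, and finiteness of the left global dimension passes from `R` to `S`. -/
theorem exists_bound_of_ker_eq_mul_idempotent {R S : Type u} [Ring R] [Ring S] (φ : R →+* S)
    (hφ : Function.Surjective φ) (e : R) (he : φ e = 0) (hker : ∀ r, φ r = 0 → r * e = r)
    (hR : ∃ n : ℕ, ∀ M : ModuleCat.{u} R, HasProjectiveDimensionLE M n) :
    ∃ n : ℕ, ∀ M : ModuleCat.{u} S, HasProjectiveDimensionLE M n := by
  obtain ⟨n, hn⟩ := hR
  refine ⟨n, fun M => ModuleCat.hasProjectiveDimensionLE_of_restrictScalars φ hφ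
    (fun P hP => ?_) n M (hn _)⟩
  let _ : Module R S := Module.compHom S φ
  let _ : Module R P := Module.compHom P φ
  have : Module.Projective R S := by
    refine Module.Projective.of_split (M := R)
      { toFun := fun s => Function.surjInv hφ s * (1 - e)
        map_add' := fun s t => ?_
        map_smul' := fun r s => ?_ }
      { φ.toAddMonoidHom with map_smul' := fun r s => map_mul φ r s } ?_
    · rw [← add_mul, ← sub_eq_zero, ← sub_mul, mul_sub, mul_one, sub_eq_zero]
      refine (hker _ ?_).symm
      simp [Function.surjInv_eq hφ]
    · rw [smul_eq_mul, ← mul_assoc, RingHom.id_apply, ← sub_eq_zero, ← sub_mul, mul_sub, mul_one,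
        sub_eq_zero]
      refine (hker _ ?_).symm
      rw [map_sub, map_mul, Function.surjInv_eq hφ, Function.surjInv_eq hφ]
      exact sub_self _
    · ext s
      change φ (Function.surjInv hφ s * (1 - e)) = s
      rw [map_mul, map_sub, he, map_one, sub_zero, mul_one, Function.surjInv_eq hφ]
  have := ModuleCat.projective_of_module_projective P
  obtain ⟨i, p, hip⟩ := Module.Projective.exists_restrictScalars_retract φ P (fun _ _ => rfl)
    (fun _ _ => rfl)
  have : Module.Projective R P := Module.Projective.of_split i p hip
  exact ModuleCat.projective_of_categoryTheory_projective (ModuleCat.of R P)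

/-! ### Triangular rings -/

section Triangular

theorem mem_of_lt_of_isLowerSet_insert {ι : Type} [LinearOrder ι] {s : Finset ι} {a : ι}
    (hs : IsLowerSet ((insert a s : Finset ι) : Set ι)) {k : ι} (hk : k < a) : k ∈ s :=
  (Finset.mem_insert.mp (hs hk.le (Finset.mem_insert_self a s))).resolve_left hk.ne

variable {R : Type u} [Ring R] {ι : Type} [Fintype ι] [LinearOrder ι] {f : ι → R}

/-- The elements of `M` supported on the lower set `s`, that is, killed by `f i` for `i ∉ s`. They
form a submodule because `f i * r * f j = 0` for `j < i`. -/
def supportedOn (hf : CompleteOrthogonalIdempotents f)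
    (htri : ∀ i j r, j < i → f i * r * f j = 0) {s : Finset ι} (hs : IsLowerSet (s : Set ι))
    (M : Type u) [AddCommGroup M] [Module R M] : Submodule R M where
  carrier := {x | ∀ i ∉ s, f i • x = 0}
  zero_mem' := fun i _ => smul_zero _
  add_mem' := fun hx hy i hi => by rw [smul_add, hx i hi, hy i hi, add_zero]
  smul_mem' := fun r x hx i hi => by
    rw [← one_smul R x, ← hf.complete, Finset.sum_smul, Finset.smul_sum, Finset.smul_sum]
    refine Finset.sum_eq_zero fun j _ => ?_
    by_cases hj : j ∈ s
    · rw [smul_smul, smul_smul,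
        htri i j r (lt_of_not_ge fun hij => hi (hs hij hj)), zero_smul]
    · rw [hx j hj, smul_zero, smul_zero]

/-- The kernel of `R (f a) → S`, where `S` is the diagonal component at `a`, is supported on the
indices below `a`. Hence a bound `c` for modules with such support gives the bound `c + 1` for
projective `S`-modules. -/
theorem hasProjectiveDimensionLT_of_projective_diagonal (hf : CompleteOrthogonalIdempotents f)
    (htri : ∀ i j r, j < i → f i * r * f j = 0) {S : Type u} [Ring S] (a : ι)
    (π : R →+* S) (hπ : Function.Surjective π) (hker : ∀ r, π r = 0 ↔ f a * r * f a = 0)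
    {s : Finset ι} (hs : IsLowerSet ((insert a s : Finset ι) : Set ι)) (c : ℕ)
    (hc : ∀ M : ModuleCat.{u} R, (∀ i ∉ s, ∀ x : M, f i • x = 0) → HasProjectiveDimensionLT M c)
    (P : ModuleCat.{u} S) (hP : Projective P) :
    HasProjectiveDimensionLT ((ModuleCat.restrictScalars π).obj P) (c + 1) := by
  let _ : Module R S := Module.compHom S π
  let _ : Module R P := Module.compHom P π
  have haa : f a * f a = f a := hf.idem a
  have hπa : π (f a) = 1 := by
    rw [← sub_eq_zero, ← map_one π, ← map_sub, hker]
    simp [mul_sub, haa]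
  let L : Submodule R R := LinearMap.range (LinearMap.toSpanSingleton R R (f a))
  have hL : ∀ x : L, (x : R) * f a = x := by
    rintro ⟨_, r, rfl⟩
    simp [mul_assoc, haa]
  have : Module.Projective R L := by
    refine Module.Projective.of_split L.subtype
      (LinearMap.toSpanSingleton R R (f a)).rangeRestrict ?_
    ext x
    simpa using hL x
  let πL : L →ₗ[R] S :=
    { toFun := fun x => π x
      map_add' := fun x y => map_add π _ _
      map_smul' := fun r x => map_mul π r x }
  let q : (Π₀ _ : P, L) →ₗ[R] Π₀ _ : P, S := DFinsupp.mapRange.linearMap fun _ => πL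
  have hq : Function.Surjective q := by
    refine (DFinsupp.mapRange_surjective _ fun _ => map_zero πL).mpr fun _ t => ?_
    obtain ⟨r, rfl⟩ := hπ t
    refine ⟨⟨r * f a, r, rfl⟩, ?_⟩
    change π (r * f a) = π r
    rw [map_mul, hπa, mul_one]
  have hS : HasProjectiveDimensionLT (ModuleCat.of R (Π₀ _ : P, S)) (c + 1) := by
    refine hasProjectiveDimensionLT_of_surjective q hq c (hc _ ?_) ?_
    · rintro k hk ⟨x, hx⟩
      ext p
      have hxp : π (x p : R) = 0 := DFunLike.congr_fun (show q x = 0 from hx) p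
      change f k * (x p : R) = 0
      rw [← hL, ← mul_assoc]
      rcases lt_trichotomy k a with h | rfl | h
      · exact absurd (mem_of_lt_of_isLowerSet_insert hs h) hk
      · exact (hker _).mp hxp
      · exact htri k a _ h
    · have : Projective (ModuleCat.of R (Π₀ _ : P, L)) :=
        ModuleCat.projective_of_categoryTheory_projective _
      exact hasProjectiveDimensionLT_of_ge _ 1 _ (by omega)
  have := ModuleCat.projective_of_module_projective P
  obtain ⟨i, p, hip⟩ := Module.Projective.exists_restrictScalars_retract π P (fun _ _ => rfl)
    (fun _ _ => rfl)
  have hr : Retract (ModuleCat.of R P) (ModuleCat.of R (Π₀ _ : P, S)) :=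
    { i := ModuleCat.ofHom i
      r := ModuleCat.ofHom p
      retract := by rw [← ModuleCat.ofHom_comp, hip]; rfl }
  exact hr.hasProjectiveDimensionLT (c + 1)

/-- A ring that is triangular with respect to finitely many orthogonal idempotents has finite left
global dimension as soon as all its diagonal components do. -/
theorem exists_bound_of_triangular (hf : CompleteOrthogonalIdempotents f)
    (htri : ∀ i j r, j < i → f i * r * f j = 0) (S : ι → Type u) [∀ a, Ring (S a)]
    (π : ∀ a, R →+* S a) (hπ : ∀ a, Function.Surjective (π a))
    (hker : ∀ a r, π a r = 0 ↔ f a * r * f a = 0)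
    (hS : ∀ a, ∃ n : ℕ, ∀ M : ModuleCat.{u} (S a), HasProjectiveDimensionLE M n) :
    ∃ n : ℕ, ∀ M : ModuleCat.{u} R, HasProjectiveDimensionLE M n := by
  suffices h : ∀ s : Finset ι, IsLowerSet (s : Set ι) → ∃ c : ℕ, ∀ M : ModuleCat.{u} R,
      (∀ i ∉ s, ∀ x : M, f i • x = 0) → HasProjectiveDimensionLT M c by
    obtain ⟨c, hc⟩ := h Finset.univ (by simpa using isLowerSet_univ)
    refine ⟨c, fun M => ?_⟩
    have := hc M (fun i hi => absurd (Finset.mem_univ i) hi)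
    exact hasProjectiveDimensionLT_of_ge M c (c + 1) (by omega)
  intro s
  induction s using Finset.induction_on_max with
  | empty =>
    intro _
    refine ⟨0, fun M hM =>
      (ModuleCat.isZero_iff_subsingleton.mpr ⟨?_⟩).hasProjectiveDimensionLT_zero⟩
    have h0 : ∀ x : M, x = 0 := fun x => by
      rw [← one_smul R x, ← hf.complete, Finset.sum_smul]
      exact Finset.sum_eq_zero fun i _ => hM i (Finset.notMem_empty i) x
    intro x y
    rw [h0 x, h0 y]
  | insert a s hsa ih =>
    intro hs
    have hs' : IsLowerSet (s : Set ι) := fun j k hkj hj =>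
      mem_of_lt_of_isLowerSet_insert hs (hkj.trans_lt (hsa j hj))
    obtain ⟨c, hc⟩ := ih hs'
    obtain ⟨n, hn⟩ := hS a
    refine ⟨n + c + 1, fun M hM => ?_⟩
    let L := supportedOn hf htri hs' M
    have hLpd : HasProjectiveDimensionLT (ModuleCat.of R L) c :=
      hc _ fun i hi x => Subtype.ext (x.2 i hi)
    -- On `M ⧸ L` only `f a` acts nontrivially, so the action of `R` factors through `S a`.
    have hQ : ∀ r, π a r = 0 → ∀ x : M ⧸ L, r • x = 0 := by
      intro r hr x
      obtain ⟨x, rfl⟩ := L.mkQ_surjective x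
      rw [← map_smul, Submodule.mkQ_apply, Submodule.Quotient.mk_eq_zero]
      intro k hk
      by_cases hka : k = a
      · subst hka
        rw [← one_smul R x, ← hf.complete, Finset.sum_smul, Finset.smul_sum, Finset.smul_sum]
        refine Finset.sum_eq_zero fun j _ => ?_
        by_cases hj : j ∈ s
        · rw [smul_smul, smul_smul, htri k j r (hsa j hj), zero_smul]
        · by_cases hjk : j = k
          · subst hjk
            rw [smul_smul, smul_smul, (hker j r).mp hr, zero_smul]
          · rw [hM j (by simp [hj, hjk]), smul_zero, smul_zero]
      · exact hM k (by simp [hk, hka]) _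
    obtain ⟨N, ⟨e⟩⟩ := ModuleCat.exists_restrictScalars_iso (π a) (hπ a) (M ⧸ L) hQ
    have hN := ModuleCat.hasProjectiveDimensionLT_restrictScalars (π a) c
      (hasProjectiveDimensionLT_of_projective_diagonal hf htri a (π a) (hπ a) (hker a) hs c hc)
      n N (hn N)
    have hQpd := hasProjectiveDimensionLT_of_iso e (n + c + 1)
    have hE : (L.mkQ).shortComplexKer.ShortExact :=
      LinearMap.shortExact_shortComplexKer L.mkQ_surjective
    refine hE.hasProjectiveDimensionLT_X₂ (n + c + 1) ?_ hQpd
    have : HasProjectiveDimensionLT (ModuleCat.of R L) (n + c + 1) :=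
      hasProjectiveDimensionLT_of_ge _ c _ (by omega)
    exact hasProjectiveDimensionLT_of_iso
      (LinearEquiv.toModuleIso (LinearEquiv.ofEq _ _ L.ker_mkQ.symm)) (n + c + 1)

end Triangular

/-! ### Morphisms of graded modules -/

namespace GrMod

variable {K : Type v} {A : Type u} [Field K] [Ring A] [Algebra K A] {𝒜 : ℤ → Submodule K A}

theorem comp_mem_Hom₀ {X Y Z : GrMod 𝒜} {g : Y.carrier →ₗ[Aᵐᵒᵖ] Z.carrier}
    {f : X.carrier →ₗ[Aᵐᵒᵖ] Y.carrier} (hg : g ∈ Y.Hom₀ Z) (hf : f ∈ X.Hom₀ Y) :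
    g ∘ₗ f ∈ X.Hom₀ Z :=
  fun i x hx => hg i _ (hf i x hx)

theorem FactorsThroughProjective.comp_left {X Y Z : GrMod 𝒜} {f : X.carrier →ₗ[Aᵐᵒᵖ] Y.carrier}
    (hf : FactorsThroughProjective (X := X) (Y := Y) f) {k : Y.carrier →ₗ[Aᵐᵒᵖ] Z.carrier}
    (hk : k ∈ Y.Hom₀ Z) : FactorsThroughProjective (X := X) (Y := Z) (k ∘ₗ f) := by
  obtain ⟨P, hP, g, hg, h, hh, rfl⟩ := hf
  exact ⟨P, hP, g, hg, k ∘ₗ h, comp_mem_Hom₀ hk hh, (LinearMap.comp_assoc _ _ _).symm⟩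

theorem FactorsThroughProjective.comp_right {X Y Z : GrMod 𝒜} {f : Y.carrier →ₗ[Aᵐᵒᵖ] Z.carrier}
    (hf : FactorsThroughProjective (X := Y) (Y := Z) f) {k : X.carrier →ₗ[Aᵐᵒᵖ] Y.carrier}
    (hk : k ∈ X.Hom₀ Y) : FactorsThroughProjective (X := X) (Y := Z) (f ∘ₗ k) := by
  obtain ⟨P, hP, g, hg, h, hh, rfl⟩ := hf
  exact ⟨P, hP, g ∘ₗ k, comp_mem_Hom₀ hg hk, h, hh, LinearMap.comp_assoc _ _ _⟩

/-- The projection onto the endomorphism ring in the stable category. -/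
def toStableEnd (X : GrMod 𝒜) : X.End₀ →+* X.StableEnd := X.projIdeal.ringCon.mk'

theorem toStableEnd_surjective (X : GrMod 𝒜) : Function.Surjective X.toStableEnd :=
  X.projIdeal.ringCon.mk'_surjective

theorem toStableEnd_eq_zero_iff {X : GrMod 𝒜} {f : X.End₀} :
    X.toStableEnd f = 0 ↔ FactorsThroughProjective (X := X) (Y := X) f.1 := by
  rw [← TwoSidedIdeal.mem_ker, toStableEnd, TwoSidedIdeal.ker_ringCon_mk', projIdeal,
    TwoSidedIdeal.mem_mk', Set.mem_ofPred_eq]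

/-! ### Stable endomorphism rings of triangular direct sums -/

section DirectSum

variable {ι : Type} [Fintype ι] (X : ι → GrMod 𝒜)

/-- The projection onto a summand. -/
def prj (i : ι) : (directSum X).carrier →ₗ[Aᵐᵒᵖ] (X i).carrier :=
  LinearMap.proj (φ := fun s => (X s).carrier) i

theorem prj_mem (i : ι) : prj X i ∈ (directSum X).Hom₀ (X i) :=
  fun _ _ hx => hx i trivial

variable [LinearOrder ι]

/-- The inclusion of a summand. -/
def incl (i : ι) : (X i).carrier →ₗ[Aᵐᵒᵖ] (directSum X).carrier :=
  LinearMap.single Aᵐᵒᵖ (fun s => (X s).carrier) i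

theorem incl_mem (i : ι) : incl X i ∈ (X i).Hom₀ (directSum X) := by
  intro k x hx t _
  by_cases h : t = i
  · subst h
    change (Pi.single t x : ∀ s, (X s).carrier) t ∈ _
    rwa [Pi.single_eq_same]
  · change (Pi.single i x : ∀ s, (X s).carrier) t ∈ _
    rw [Pi.single_eq_of_ne h]
    exact ((X t).deg k).zero_mem

theorem prj_incl_same (i : ι) (x : (X i).carrier) : prj X i (incl X i x) = x :=
  Pi.single_eq_same (M := fun s => (X s).carrier) i x

theorem prj_incl_of_ne {i j : ι} (h : i ≠ j) (x : (X j).carrier) : prj X i (incl X j x) = 0 :=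
  Pi.single_eq_of_ne (M := fun s => (X s).carrier) h x

theorem sum_incl_prj (x : (directSum X).carrier) : ∑ i, incl X i (prj X i x) = x :=
  Finset.univ_sum_single (M := fun i => (X i).carrier) x

/-- The idempotent of `End (⨁ X)` given by a summand. -/
def summandIdem (i : ι) : (directSum X).End₀ :=
  ⟨incl X i ∘ₗ prj X i, comp_mem_Hom₀ (incl_mem X i) (prj_mem X i)⟩

theorem completeOrthogonalIdempotents_summandIdem :
    CompleteOrthogonalIdempotents (summandIdem X) where
  idem i := Subtype.ext (LinearMap.ext fun x => congrArg (incl X i) (prj_incl_same X i _))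
  ortho i j h := Subtype.ext (LinearMap.ext fun x =>
    (congrArg (incl X i) (prj_incl_of_ne X h _)).trans (map_zero _))
  complete := Subtype.ext (LinearMap.ext fun x => by
    rw [AddSubmonoidClass.coe_finsetSum, LinearMap.sum_apply]
    exact sum_incl_prj X x)

variable {X}

/-- The component of an endomorphism of `⨁ X` on the diagonal. It is multiplicative because the
matrices of endomorphisms are triangular. -/
def diagonal (hX : ∀ i j, j < i → ∀ g ∈ (X i).Hom₀ (X j), g = 0) (a : ι) :
    (directSum X).End₀ →+* (X a).End₀ where
  toFun φ := ⟨prj X a ∘ₗ φ.1 ∘ₗ incl X a,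
    comp_mem_Hom₀ (prj_mem X a) (comp_mem_Hom₀ φ.2 (incl_mem X a))⟩
  map_one' := Subtype.ext (LinearMap.ext fun x => prj_incl_same X a x)
  map_zero' := Subtype.ext (LinearMap.ext fun x => map_zero (prj X a))
  map_add' φ ψ := Subtype.ext (LinearMap.ext fun x => map_add (prj X a) _ _)
  map_mul' φ ψ := Subtype.ext (LinearMap.ext fun x => by
    change prj X a (φ.1 (ψ.1 (incl X a x))) =
      prj X a (φ.1 (incl X a (prj X a (ψ.1 (incl X a x)))))
    conv_lhs => rw [← sum_incl_prj X (ψ.1 (incl X a x)), map_sum, map_sum]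
    refine Finset.sum_eq_single a (fun k _ hk => ?_) (fun h => absurd (Finset.mem_univ a) h)
    rcases lt_or_gt_of_ne hk with h | h
    · have := hX a k h (prj X k ∘ₗ ψ.1 ∘ₗ incl X a)
        (comp_mem_Hom₀ (prj_mem X k) (comp_mem_Hom₀ ψ.2 (incl_mem X a)))
      have hz : prj X k (ψ.1 (incl X a x)) = 0 := LinearMap.congr_fun this x
      rw [hz, map_zero, map_zero, map_zero]
    · exact LinearMap.congr_fun (hX k a h (prj X a ∘ₗ φ.1 ∘ₗ incl X k)
        (comp_mem_Hom₀ (prj_mem X a) (comp_mem_Hom₀ φ.2 (incl_mem X k)))) _)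

/-- The kernel of the diagonal component in the stable category is cut out by the idempotent of the
summand. -/
theorem factorsThroughProjective_diagonal_iff
    (hX : ∀ i j, j < i → ∀ g ∈ (X i).Hom₀ (X j), g = 0) (a : ι) (φ : (directSum X).End₀) :
    FactorsThroughProjective (X := X a) (Y := X a) (diagonal hX a φ).1 ↔
      FactorsThroughProjective (X := directSum X) (Y := directSum X)
        (summandIdem X a * φ * summandIdem X a).1 := by
  constructor
  · intro h
    exact (h.comp_left (incl_mem X a)).comp_right (prj_mem X a)
  · intro h
    have := (h.comp_left (prj_mem X a)).comp_right (incl_mem X a)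
    convert this using 1
    ext x
    change _ = prj X a (incl X a (prj X a (φ.1 (incl X a (prj X a (incl X a x))))))
    rw [prj_incl_same, prj_incl_same]
    rfl

/-- The map induced by `diagonal` on stable endomorphism rings. -/
def stableDiagonal (hX : ∀ i j, j < i → ∀ g ∈ (X i).Hom₀ (X j), g = 0) (a : ι) :
    (directSum X).StableEnd →+* (X a).StableEnd :=
  (directSum X).projIdeal.ringCon.lift ((X a).toStableEnd.comp (diagonal hX a)) (by
    intro φ ψ h
    rw [TwoSidedIdeal.rel_iff, projIdeal, TwoSidedIdeal.mem_mk', Set.mem_ofPred_eq] at h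
    change (X a).toStableEnd (diagonal hX a φ) = (X a).toStableEnd (diagonal hX a ψ)
    rw [← sub_eq_zero, ← map_sub, ← map_sub, toStableEnd_eq_zero_iff]
    exact (h.comp_left (prj_mem X a)).comp_right (incl_mem X a))

theorem stableDiagonal_toStableEnd (hX : ∀ i j, j < i → ∀ g ∈ (X i).Hom₀ (X j), g = 0) (a : ι)
    (φ : (directSum X).End₀) :
    stableDiagonal hX a ((directSum X).toStableEnd φ) = (X a).toStableEnd (diagonal hX a φ) :=
  rfl

theorem stableDiagonal_surjective (hX : ∀ i j, j < i → ∀ g ∈ (X i).Hom₀ (X j), g = 0) (a : ι) :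
    Function.Surjective (stableDiagonal hX a) := by
  intro y
  obtain ⟨g, rfl⟩ := (X a).toStableEnd_surjective y
  refine ⟨(directSum X).toStableEnd ⟨incl X a ∘ₗ g.1 ∘ₗ prj X a,
    comp_mem_Hom₀ (incl_mem X a) (comp_mem_Hom₀ g.2 (prj_mem X a))⟩, ?_⟩
  rw [stableDiagonal_toStableEnd]
  congr 1
  refine Subtype.ext (LinearMap.ext fun x => ?_)
  change prj X a (incl X a (g.1 (prj X a (incl X a x)))) = g.1 x
  rw [prj_incl_same, prj_incl_same]

/-- If there are no nonzero morphisms `X i → X j` for `j < i`, then the stable endomorphism ring of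
`⨁ X` is triangular with the stable endomorphism rings of the `X a` on the diagonal, and finiteness
of global dimension passes from the latter to the former. -/
theorem hasFiniteGlobalDimension_stableEnd_directSum
    (hX : ∀ i j, j < i → ∀ g ∈ (X i).Hom₀ (X j), g = 0)
    (h : ∀ a, HasFiniteGlobalDimension (X a).StableEnd) :
    HasFiniteGlobalDimension (directSum X).StableEnd := by
  let p := (directSum X).toStableEnd
  have hidem := (completeOrthogonalIdempotents_summandIdem X).map p
  have hf : CompleteOrthogonalIdempotents (fun i => MulOpposite.op (p (summandIdem X i))) :=
    { idem := fun i => congrArg MulOpposite.op (hidem.idem i)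
      ortho := fun i j hij => congrArg MulOpposite.op (hidem.ortho hij.symm)
      complete := by
        rw [← Finset.op_sum]
        exact congrArg MulOpposite.op hidem.complete }
  refine exists_bound_of_triangular hf ?_ (fun a => (X a).StableEndᵐᵒᵖ)
    (fun a => (stableDiagonal hX a).op) (fun a y => ?_) ?_ h
  · intro i j r hij
    obtain ⟨φ, hφ⟩ := (directSum X).toStableEnd_surjective r.unop
    refine MulOpposite.unop_injective ?_
    change p (summandIdem X j) * (r.unop * p (summandIdem X i)) = 0
    rw [← hφ, ← map_mul, ← map_mul]
    have : summandIdem X j * (φ * summandIdem X i) = 0 := by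
      refine Subtype.ext (LinearMap.ext fun x => ?_)
      have h0 := LinearMap.congr_fun (hX i j hij (prj X j ∘ₗ φ.1 ∘ₗ incl X i)
        (comp_mem_Hom₀ (prj_mem X j) (comp_mem_Hom₀ φ.2 (incl_mem X i)))) (prj X i x)
      exact (congrArg (incl X j) h0).trans (map_zero _)
    rw [this, map_zero]
  · obtain ⟨x, hx⟩ := stableDiagonal_surjective hX a y.unop
    exact ⟨MulOpposite.op x, MulOpposite.unop_injective hx⟩
  · intro a r
    obtain ⟨φ, hφ⟩ := (directSum X).toStableEnd_surjective r.unop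
    obtain rfl : r = MulOpposite.op (p φ) := MulOpposite.unop_injective hφ.symm
    rw [← MulOpposite.op_mul, ← MulOpposite.op_mul, ← mul_assoc, ← map_mul, ← map_mul,
      MulOpposite.op_eq_zero_iff, toStableEnd_eq_zero_iff,
      ← factorsThroughProjective_diagonal_iff hX, ← toStableEnd_eq_zero_iff]
    exact MulOpposite.op_eq_zero_iff _

end DirectSum

end GrMod

/-! ### The modules `A(m)_{≤ 0}` -/

namespace GrMod

variable {K : Type v} {A : Type u} [Field K] [Ring A] [Algebra K A] {𝒜 : ℤ → Submodule K A}

/-- Graded morphisms commute with the projections onto homogeneous components. -/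
theorem proj_comm {X Y : GrMod 𝒜} {e : X.carrier →ₗ[Aᵐᵒᵖ] Y.carrier} (he : e ∈ X.Hom₀ Y)
    {p : ℤ → X.carrier →+ X.carrier} (hp : ∀ i, ∀ x ∈ X.deg i, p i x = x)
    (hp' : ∀ i j, i ≠ j → ∀ x ∈ X.deg j, p i x = 0) {q : ℤ → Y.carrier →+ Y.carrier}
    (hq : ∀ i, ∀ x ∈ Y.deg i, q i x = x) (hq' : ∀ i j, i ≠ j → ∀ x ∈ Y.deg j, q i x = 0)
    (i : ℤ) (x : X.carrier) : e (p i x) = q i (e x) := by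
  refine mem_of_deg_le X.isInternal
    ((e.toAddMonoidHom.comp (p i)).eqLocus ((q i).comp e.toAddMonoidHom)) (fun j y hy => ?_) x
  change e (p i y) = q i (e y)
  by_cases h : i = j
  · subst h
    rw [hp i y hy, hq i _ (he i y hy)]
  · rw [hp' i j h y hy, hq' i j h _ (he j y hy), map_zero]

variable [GradedAlgebra 𝒜]

/-- `A(n)` is projective, since it is generated freely by `1` in degree `-n`. -/
theorem isProjective_shift_regular (n : ℤ) : ((regular 𝒜).shift n).IsProjective := by
  intro X Y e he hs f hf
  -- A preimage of `f 1` can be replaced by its component in degree `-n`.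
  obtain ⟨p, hp, hp1, hp2⟩ := exists_proj X.isInternal
  obtain ⟨q, -, hq1, hq2⟩ := exists_proj Y.isInternal
  have h1 : f (1 : A) ∈ Y.deg (-n) := by
    refine hf (-n) (1 : A) ?_
    change (1 : A) ∈ 𝒜 (-n + n)
    rw [neg_add_cancel]
    exact SetLike.GradedOne.one_mem
  obtain ⟨x, hx⟩ := hs (f (1 : A))
  let g : A →ₗ[Aᵐᵒᵖ] X.carrier :=
    { toFun := fun a => MulOpposite.op a • p (-n) x
      map_add' := fun a b => by rw [MulOpposite.op_add, add_smul]
      map_smul' := fun c a => by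
        rw [RingHom.id_apply, smul_smul]
        rfl }
  refine ⟨g, fun j (a : A) ha => ?_, LinearMap.ext fun (a : A) => ?_⟩
  · have := X.smul_mem (hp (-n) x) (show a ∈ 𝒜 (j + n) from ha)
    rwa [show -n + (j + n) = j by ring] at this
  · change e (MulOpposite.op (a : A) • p (-n) x) = f a
    rw [map_smul, proj_comm he hp1 hp2 hq1 hq2, hx, hq1 _ _ h1]
    exact (f.map_smul (MulOpposite.op a) (1 : A)).symm.trans (congrArg f (one_mul a))

variable (𝒜)

/-- `A_{> m}`, in the form `A(m)_{≥ 1}` whose quotient is the carrier of `A(m)_{≤ 0}`. -/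
def tail (m : ℤ) : Submodule Aᵐᵒᵖ A := ((regular 𝒜).shift m).truncGE (0 + 1)

variable {𝒜}

theorem mem_tail {m k : ℤ} (hk : m < k) {x : A} (hx : x ∈ 𝒜 k) : x ∈ tail 𝒜 m := by
  refine Submodule.subset_span (R := Aᵐᵒᵖ) (M := ((regular 𝒜).shift m).carrier)
    ⟨k - m, by omega, ?_⟩
  change x ∈ 𝒜 (k - m + m)
  rwa [sub_add_cancel]

theorem eq_zero_of_mem_tail (hpos : ∀ i < 0, 𝒜 i = ⊥) {m k : ℤ} (hk : k ≤ m) {x : A}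
    (hx : x ∈ 𝒜 k) (hxt : x ∈ tail 𝒜 m) : x = 0 := by
  have hx' : x ∈ ((regular 𝒜).shift m).deg (k - m) := by
    change x ∈ 𝒜 (k - m + m)
    rwa [sub_add_cancel]
  exact ((mem_truncGE_iff hpos _ _ hx').mp hxt).resolve_left (by omega)

theorem decompose_mem_tail {m : ℤ} {x : A} (hx : x ∈ tail 𝒜 m) (k : ℤ) :
    (DirectSum.decompose 𝒜 x k : A) ∈ tail 𝒜 m := by
  obtain ⟨p, h1, h2, h3⟩ := exists_proj ((regular 𝒜).shift m).isInternal
  have hp := proj_mem_truncGE _ _ h1 h2 h3 x hx (k - m)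
  have : ∀ y : A, p (k - m) y = (DirectSum.decompose 𝒜 y k : A) := by
    refine mem_of_deg_le (regular 𝒜).isInternal ((p (k - m)).eqLocus
      (M := ((regular 𝒜).shift m).carrier) (GradedRing.proj 𝒜 k : A →+ A))
      (fun j (y : A) (hy : y ∈ 𝒜 j) => ?_)
    change p (k - m) y = (DirectSum.decompose 𝒜 y k : A)
    have hy' : y ∈ ((regular 𝒜).shift m).deg (j - m) := by
      change y ∈ 𝒜 (j - m + m)
      rwa [sub_add_cancel]
    by_cases h : j = k
    · subst h
      exact (h2 _ y hy').trans (DirectSum.decompose_of_mem_same 𝒜 hy).symm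
    · exact (h3 _ _ (fun h' => h (by omega)) y hy').trans
        (DirectSum.decompose_of_mem_ne 𝒜 hy h).symm
  exact this x ▸ hp

theorem mul_mem_tail {m : ℤ} {a : A} (ha : a ∈ 𝒜 0) :
    tail 𝒜 m ≤ (tail 𝒜 m).comap (Module.toModuleEnd Aᵐᵒᵖ A a) := by
  refine Submodule.span_le.mpr ?_
  rintro (x : A) ⟨j, hj, hx⟩
  refine mem_tail (k := j + m) (by omega) ?_
  have := SetLike.GradedMul.mul_mem (A := 𝒜) ha (show x ∈ 𝒜 (j + m) from hx)
  rwa [zero_add] at this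

/-- Right self-injectivity of `A` makes the left annihilator of `A_{> m}` in `A_0` a right ideal
generated by an idempotent: extending the inclusion of the right ideal generated by this annihilator
along its embedding into `A / A_{> m}` yields a left multiplication, whose degree zero part is a
left identity of the annihilator. -/
theorem exists_left_identity_annihilator (hpos : ∀ i < 0, 𝒜 i = ⊥) (hinj : Module.Injective Aᵐᵒᵖ A)
    (m : ℤ) : ∃ e ∈ 𝒜 0, (∀ x ∈ tail 𝒜 m, e * x = 0) ∧
      ∀ a ∈ 𝒜 0, (∀ x ∈ tail 𝒜 m, a * x = 0) → e * a = a := by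
  classical
  let J : Set A := {a | a ∈ 𝒜 0 ∧ ∀ x ∈ tail 𝒜 m, a * x = 0}
  let B : Submodule Aᵐᵒᵖ A := Submodule.span Aᵐᵒᵖ J
  -- Right multiples are included in the claim so that it is inherited by the span.
  have hB : ∀ x ∈ B, ∀ c : A, ∀ k, m < k → (DirectSum.decompose 𝒜 (x * c) k : A) = 0 := by
    intro x hx
    induction hx using Submodule.span_induction with
    | mem a ha =>
      intro c k hk
      rw [DirectSum.coe_decompose_mul_of_left_mem_zero 𝒜 ha.1]
      exact ha.2 _ (mem_tail hk (SetLike.coe_mem _))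
    | zero => intro c k _; simp
    | add x y _ _ hx hy =>
      intro c k hk
      rw [add_mul, DirectSum.decompose_add, DirectSum.add_apply, Submodule.coe_add, hx c k hk,
        hy c k hk, add_zero]
    | smul a x _ hx =>
      intro c k hk
      rw [MulOpposite.smul_eq_mul_unop, mul_assoc]
      exact hx _ k hk
  have hdisj : ∀ x ∈ B, x ∈ tail 𝒜 m → x = 0 := by
    intro x hxB hxt
    rw [← DirectSum.sum_support_decompose 𝒜 x]
    refine Finset.sum_eq_zero fun k _ => ?_
    rcases lt_or_ge m k with hk | hk
    · simpa using hB x hxB 1 k hk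
    · exact eq_zero_of_mem_tail hpos hk (SetLike.coe_mem _) (decompose_mem_tail hxt k)
  obtain ⟨h, hh⟩ := hinj.out ((tail 𝒜 m).mkQ ∘ₗ B.subtype) (by
    rw [injective_iff_map_eq_zero]
    intro x hx
    exact Subtype.ext (hdisj x x.2 ((Submodule.Quotient.mk_eq_zero _).mp hx))) B.subtype
  let a : A := h ((tail 𝒜 m).mkQ 1)
  have ha : ∀ x : A, h ((tail 𝒜 m).mkQ x) = a * x := by
    intro x
    have := map_smul (h ∘ₗ (tail 𝒜 m).mkQ) (MulOpposite.op x) (1 : A)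
    rw [MulOpposite.smul_eq_mul_unop, MulOpposite.unop_op, one_mul] at this
    exact this
  refine ⟨DirectSum.decompose 𝒜 a 0, SetLike.coe_mem _, ?_, ?_⟩
  · have hle : tail 𝒜 m ≤ LinearMap.ker
        (Module.toModuleEnd Aᵐᵒᵖ A (DirectSum.decompose 𝒜 a 0 : A)) := by
      refine Submodule.span_le.mpr ?_
      rintro (x : A) ⟨j, hj, hx⟩
      have hx : x ∈ 𝒜 (j + m) := hx
      have h0 : a * x = 0 := by
        rw [← ha, Submodule.mkQ_apply,
          (Submodule.Quotient.mk_eq_zero _).mpr (mem_tail (by omega) hx), map_zero]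
      change (DirectSum.decompose 𝒜 a 0 : A) * x = 0
      rw [← DirectSum.coe_decompose_mul_add_of_right_mem 𝒜 hx, h0]
      simp
    exact fun x hx => hle hx
  · intro b hb hbx
    have hab : a * b = b := by
      rw [← ha]
      exact hh ⟨b, Submodule.subset_span ⟨hb, hbx⟩⟩
    rw [← DirectSum.coe_decompose_mul_of_right_mem_zero 𝒜 hb, hab,
      DirectSum.decompose_of_mem_same 𝒜 hb]

theorem mkQ_tail_mem (m : ℤ) :
    (tail 𝒜 m).mkQ ∈ ((regular 𝒜).shift m).Hom₀ (shiftTrunc 𝒜 m) :=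
  fun _ x hx => ⟨x, hx, rfl⟩

theorem one_mem_shift (m : ℤ) : (1 : A) ∈ ((regular 𝒜).shift m).deg (-m) := by
  change (1 : A) ∈ 𝒜 (-m + m)
  rw [neg_add_cancel]
  exact SetLike.GradedOne.one_mem

/-- A morphism out of `A(m)_{≤ 0}` is determined by the image of `1`. -/
theorem hom_shiftTrunc_apply {m : ℤ} {Y : Type u} [AddCommGroup Y] [Module Aᵐᵒᵖ Y]
    (g : (A ⧸ tail 𝒜 m) →ₗ[Aᵐᵒᵖ] Y) (x : A) :
    g ((tail 𝒜 m).mkQ x) = MulOpposite.op x • g ((tail 𝒜 m).mkQ 1) := by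
  rw [← map_smul, ← map_smul, MulOpposite.smul_eq_mul_unop, MulOpposite.unop_op, one_mul]

theorem exists_apply_one {m n : ℤ} {g : (shiftTrunc 𝒜 m).carrier →ₗ[Aᵐᵒᵖ] (shiftTrunc 𝒜 n).carrier}
    (hg : g ∈ (shiftTrunc 𝒜 m).Hom₀ (shiftTrunc 𝒜 n)) :
    ∃ a ∈ 𝒜 (-m + n), g ((tail 𝒜 m).mkQ 1) = (tail 𝒜 n).mkQ a := by
  obtain ⟨a, ha, h⟩ := hg (-m) _ (mkQ_tail_mem m (-m) (1 : A) (one_mem_shift (A := A) (𝒜 := 𝒜) m))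
  exact ⟨a, ha, h.symm⟩

theorem hom_shiftTrunc_eq_zero (hpos : ∀ i < 0, 𝒜 i = ⊥) {m n : ℤ} (hnm : n < m)
    {g : (shiftTrunc 𝒜 m).carrier →ₗ[Aᵐᵒᵖ] (shiftTrunc 𝒜 n).carrier}
    (hg : g ∈ (shiftTrunc 𝒜 m).Hom₀ (shiftTrunc 𝒜 n)) : g = 0 := by
  obtain ⟨a, ha, h⟩ := exists_apply_one hg
  rw [hpos _ (by omega), Submodule.mem_bot] at ha
  rw [ha, map_zero] at h
  refine LinearMap.ext fun x => ?_
  obtain ⟨x, rfl⟩ := (tail 𝒜 m).mkQ_surjective x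
  exact (hom_shiftTrunc_apply g x).trans ((congrArg (MulOpposite.op x • ·) h).trans
    (smul_zero (A := A ⧸ tail 𝒜 n) (MulOpposite.op x)))

variable (𝒜) in
/-- The action of `A_0` on `A(m)_{≤ 0}` by left multiplication. -/
def leftMul (m : ℤ) : 𝒜 0 →+* (shiftTrunc 𝒜 m).End₀ where
  toFun a := ⟨(tail 𝒜 m).mapQ (tail 𝒜 m) (Module.toModuleEnd Aᵐᵒᵖ A (a : A)) (mul_mem_tail a.2), by
    rintro j _ ⟨(x : A), hx, rfl⟩
    refine ⟨(a : A) * x, ?_, rfl⟩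
    have := SetLike.GradedMul.mul_mem (A := 𝒜) a.2 (show x ∈ 𝒜 (j + m) from hx)
    rwa [zero_add] at this⟩
  map_one' := by
    refine Subtype.ext (LinearMap.ext fun x => ?_)
    obtain ⟨x, rfl⟩ := (tail 𝒜 m).mkQ_surjective x
    exact congrArg (tail 𝒜 m).mkQ (one_mul x)
  map_zero' := by
    refine Subtype.ext (LinearMap.ext fun x => ?_)
    obtain ⟨x, rfl⟩ := (tail 𝒜 m).mkQ_surjective x
    exact (congrArg (tail 𝒜 m).mkQ (zero_mul x)).trans (map_zero _)
  map_mul' a b := by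
    refine Subtype.ext (LinearMap.ext fun x => ?_)
    obtain ⟨x, rfl⟩ := (tail 𝒜 m).mkQ_surjective x
    exact congrArg (tail 𝒜 m).mkQ (mul_assoc (a : A) b x)
  map_add' a b := by
    refine Subtype.ext (LinearMap.ext fun x => ?_)
    obtain ⟨x, rfl⟩ := (tail 𝒜 m).mkQ_surjective x
    exact (congrArg (tail 𝒜 m).mkQ (add_mul (a : A) b x)).trans (map_add _ _ _)

theorem leftMul_apply (m : ℤ) (a : 𝒜 0) (x : A) :
    (leftMul 𝒜 m a).1 ((tail 𝒜 m).mkQ x) = (tail 𝒜 m).mkQ ((a : A) * x) :=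
  rfl

theorem leftMul_surjective (m : ℤ) : Function.Surjective (leftMul 𝒜 m) := by
  intro g
  obtain ⟨a, ha, h⟩ := exists_apply_one g.2
  rw [neg_add_cancel] at ha
  refine ⟨⟨a, ha⟩, Subtype.ext (LinearMap.ext fun x => ?_)⟩
  obtain ⟨x, rfl⟩ := (tail 𝒜 m).mkQ_surjective x
  refine ((hom_shiftTrunc_apply g.1 x).trans ((congrArg (MulOpposite.op x • ·) h).trans ?_)).symm
  exact (map_smul (tail 𝒜 m).mkQ (MulOpposite.op x) a).symm

/-- Left multiplication by `a` factors through a projective if and only if it lifts along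
`A(m) → A(m)_{≤ 0}`, the only possible lift being left multiplication by `a` again. -/
theorem factorsThroughProjective_leftMul_iff (hpos : ∀ i < 0, 𝒜 i = ⊥) {m : ℤ} (hm : 0 ≤ m)
    (a : 𝒜 0) : FactorsThroughProjective (X := shiftTrunc 𝒜 m) (Y := shiftTrunc 𝒜 m)
      (leftMul 𝒜 m a).1 ↔ ∀ x ∈ tail 𝒜 m, (a : A) * x = 0 := by
  constructor
  · rintro ⟨P, hP, g, hg, h, hh, hgh⟩ x hx
    obtain ⟨h', hh', hlift⟩ := hP _ _ _ (mkQ_tail_mem m) (tail 𝒜 m).mkQ_surjective h hh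
    let k : (A ⧸ tail 𝒜 m) →ₗ[Aᵐᵒᵖ] A := h' ∘ₗ g
    have hk0 : k ((tail 𝒜 m).mkQ 1) ∈ 𝒜 0 := by
      have := hh' _ _ (hg _ _ (mkQ_tail_mem m (-m) (1 : A) (one_mem_shift (A := A) (𝒜 := 𝒜) m)))
      change _ ∈ 𝒜 (-m + m) at this
      rwa [neg_add_cancel] at this
    have hk : k ((tail 𝒜 m).mkQ 1) = a := by
      rw [← sub_eq_zero]
      refine eq_zero_of_mem_tail hpos hm (sub_mem hk0 a.2) ?_
      rw [← Submodule.Quotient.mk_eq_zero, ← Submodule.mkQ_apply, map_sub, sub_eq_zero]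
      refine (LinearMap.congr_fun hlift (g ((tail 𝒜 m).mkQ 1))).trans
        ((LinearMap.congr_fun hgh ((tail 𝒜 m).mkQ 1)).symm.trans ?_)
      rw [leftMul_apply, mul_one]
    have := hom_shiftTrunc_apply k x
    rw [hk, Submodule.mkQ_apply, (Submodule.Quotient.mk_eq_zero _).mpr hx, map_zero] at this
    exact this.symm
  · intro h
    refine ⟨(regular 𝒜).shift m, isProjective_shift_regular m,
      (tail 𝒜 m).liftQ (Module.toModuleEnd Aᵐᵒᵖ A (a : A)) h, ?_, (tail 𝒜 m).mkQ,
      mkQ_tail_mem m, ?_⟩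
    · rintro j _ ⟨(x : A), hx, rfl⟩
      have := SetLike.GradedMul.mul_mem (A := 𝒜) a.2 (show x ∈ 𝒜 (j + m) from hx)
      rwa [zero_add] at this
    · refine LinearMap.ext fun x => ?_
      obtain ⟨x, rfl⟩ := (tail 𝒜 m).mkQ_surjective x
      rfl

/-- The stable endomorphism ring of `A(m)_{≤ 0}` is the quotient of `A_0` by the left annihilator of
`A_{> m}`, an ideal of the form `e A_0`. -/
theorem hasFiniteGlobalDimension_stableEnd_shiftTrunc (hpos : ∀ i < 0, 𝒜 i = ⊥)
    (hinj : Module.Injective Aᵐᵒᵖ A) (hA₀ : HasFiniteGlobalDimension (𝒜 0)) {m : ℤ} (hm : 0 ≤ m) :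
    HasFiniteGlobalDimension (shiftTrunc 𝒜 m).StableEnd := by
  obtain ⟨e, he0, he, hid⟩ := exists_left_identity_annihilator hpos hinj m
  let φ := (shiftTrunc 𝒜 m).toStableEnd.comp (leftMul 𝒜 m)
  have hφ : ∀ a, φ a = 0 ↔ ∀ x ∈ tail 𝒜 m, (a : A) * x = 0 := fun a =>
    toStableEnd_eq_zero_iff.trans (factorsThroughProjective_leftMul_iff hpos hm a)
  refine exists_bound_of_ker_eq_mul_idempotent φ.op (fun y => ?_) (MulOpposite.op ⟨e, he0⟩) ?_ ?_
    hA₀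
  · obtain ⟨x, hx⟩ := ((toStableEnd_surjective _).comp (leftMul_surjective m)) y.unop
    exact ⟨MulOpposite.op x, MulOpposite.unop_injective hx⟩
  · exact MulOpposite.unop_injective ((hφ _).mpr he)
  · intro r hr
    refine MulOpposite.unop_injective (Subtype.ext ?_)
    exact hid _ r.unop.2 ((hφ _).mp (congrArg MulOpposite.unop hr))

end GrMod

theorem mainTheorem5 {K : Type v} {A : Type u} [Field K] [IsAlgClosed K] [Ring A] [Algebra K A]
    [FiniteDimensional K A] (𝒜 : ℤ → Submodule K A) [GradedAlgebra 𝒜]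
    (hpos : ∀ i < 0, 𝒜 i = ⊥) (hinj : Module.Injective Aᵐᵒᵖ A)
    (hA₀ : HasFiniteGlobalDimension (𝒜 0))
    (S : Finset ℕ) (hS : ∀ i : ℕ, i ∉ S → (GrMod.shiftTrunc 𝒜 i).IsProjective) :
    HasFiniteGlobalDimension (GrMod.truncSum 𝒜 S).StableEnd := by
  refine GrMod.hasFiniteGlobalDimension_stableEnd_directSum ?_ fun a =>
    GrMod.hasFiniteGlobalDimension_stableEnd_shiftTrunc hpos hinj hA₀ (Int.natCast_nonneg _)
  intro i j hij g hg
  exact GrMod.hom_shiftTrunc_eq_zero hpos (Int.ofNat_lt.mpr hij) hg
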